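/- A $k$-graph $H$ is a finite vertex set $V(H)$ with a collection of $k$-element subsets of $V(H)$, called edges. Let $[k]=\{1,\dots,k\}$ and let $\mathcal I$ be a collection of subsets of $[k]$. An $\mathcal I$-layout in $H$ is a family $\Lambda=(\lambda_I)_{I\in\mathcal I}$, where $\lambda_I$ is an $|I|$-uniform hypergraph on vertex set $V(H)$. Let $K_k(\Lambda)$ be the set of tuples $(x_1,\dots,x_k)$ of distinct vertices of $H$ with $\{x_i:i\in I\}\in\lambda_I$ for every $I\in\mathcal I$, and let $H\cap K_k(\Lambda)$ be the set of those tuples in $K_k(\Lambda)$ for which $\{x_1,\dots,x_k\}$ is an edge of $H$. For real $p,\mu\in(0,1)$, $H$ satisfies $\mathrm{Disc}^{(k)}(\mathcal I,\ge p,\mu)$ if $$|H\cap K_k(\Lambda)|\ \ge\ p\,|K_k(\Lambda)|-\mu\,|V(H)|^k$$ for every $\mathcal I$-layout $\Lambda$ in $H$. The link $L_H(x)$ of a vertex $x$ is the $(k-1)$-graph with vertex set $V(H)\setminus\{x\}$ whose edges are the sets $T\subseteq V(H)\setminus\{x\}$ such that $T\cup\{x\}$ is an edge of $H$. Write $\binom{[m]}{\ell}$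 for the collection of $\ell$-element subsets of $[m]$, and $K_r^{(k)}$ for the complete $k$-graph on $r$ vertices. $H$ has a perfect $K_r^{(k)}$-packing if $V(H)$ can be partitioned into vertex sets of copies of $K_r^{(k)}$ in $H$. Corollary 2. Fix integers $2\le k\le r$. For every $0<\alpha,p<1$ there exist $\mu\in(0,1)$ and $n_0$ such that the following holds. Let $H$ be a $k$-graph with $n\ge n_0$ vertices, where $r\mid n$. If $H$ satisfies $\mathrm{Disc}^{(k)}\big(\binom{[k]}{k-1},\ge p,\mu\big)$ and, for every $x\in V(H)$, the link $L_H(x)$ satisfies $\mathrm{Disc}^{(k-1)}\big(\binom{[k-1]}{k-2},\ge\alpha,\mu\big)$, then $H$ has a perfect $K_r^{(k)}$-packing. -/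

import Mathlib

namespace Hypergraph

variable {α β : Type*}

/-- All edges of `H` have exactly `k` elements: `H` is a `k`-graph. -/
def IsUniform (H : Hypergraph α) (k : ℕ) : Prop :=
  ∀ e ∈ H.edgeSet, e.encard = k

/-- The link of `x` in `H`: its vertex set is `V(H) - {x}` and its edges are the sets
`T ⊆ V(H) - {x}` such that `T ∪ {x}` is an edge of `H`. -/
def link (H : Hypergraph α) (x : α) : Hypergraph α where
  vertexSet := H.vertexSet \ {x}
  edgeSet := {T | T ⊆ H.vertexSet \ {x} ∧ insert x T ∈ H.edgeSet}
  subset_vertexSet_of_mem_edgeSet' := fun _ hT => hT.1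

/-- `Λ` is an `𝓘`-layout in `H`: for every `I ∈ 𝓘`, `Λ I` is an `|I|`-uniform hypergraph on
the vertex set of `H`. The index set `[k]` is `Fin k`; values of `Λ` outside `𝓘` are irrelevant. -/
def IsLayout (H : Hypergraph α) {k : ℕ} (𝓘 : Finset (Finset (Fin k)))
    (Λ : Finset (Fin k) → Hypergraph α) : Prop :=
  ∀ I ∈ 𝓘, (Λ I).vertexSet = H.vertexSet ∧ (Λ I).IsUniform I.card

/-- The `k`-cliques `K_k(Λ)` of an `𝓘`-layout `Λ` in `H`: the tuples `(x_1, …, x_k)` of distinct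
vertices of `H` such that `{x_i : i ∈ I}` is an edge of `Λ I` for each `I ∈ 𝓘`. -/
def layoutCliques (H : Hypergraph α) {k : ℕ} (𝓘 : Finset (Finset (Fin k)))
    (Λ : Finset (Fin k) → Hypergraph α) : Set (Fin k → α) :=
  {x | Function.Injective x ∧ (∀ i, x i ∈ H.vertexSet) ∧
    ∀ I ∈ 𝓘, x '' (I : Set (Fin k)) ∈ (Λ I).edgeSet}

/-- The one-sided discrepancy property `Disc^{(k)}(𝓘, ≥ p, μ)` of a `k`-graph `H`:
`|H ∩ K_k(Λ)| ≥ p |K_k(Λ)| - μ v(H)^k` for every `𝓘`-layout `Λ` in `H`. -/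
def DiscGE (H : Hypergraph α) {k : ℕ} (𝓘 : Finset (Finset (Fin k))) (p μ : ℝ) : Prop :=
  ∀ Λ : Finset (Fin k) → Hypergraph α, H.IsLayout 𝓘 Λ →
    p * ((H.layoutCliques 𝓘 Λ).ncard : ℝ) - μ * (H.vertexSet.ncard : ℝ) ^ k ≤
      (({x ∈ H.layoutCliques 𝓘 Λ | Set.range x ∈ H.edgeSet}).ncard : ℝ)

/-- There is a (not necessarily induced) copy of `F` in `H` with vertex set `S`. -/
def HasCopyOn (F : Hypergraph β) (H : Hypergraph α) (S : Set α) : Prop :=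
  ∃ φ : β → α, Set.InjOn φ F.vertexSet ∧ φ '' F.vertexSet = S ∧
    ∀ e ∈ F.edgeSet, φ '' e ∈ H.edgeSet

/-- `H` has a perfect `F`-packing: the vertex set of `H` can be partitioned into copies of `F`. -/
def HasPerfectPacking (F : Hypergraph β) (H : Hypergraph α) : Prop :=
  ∃ P : Set (Set α), P.PairwiseDisjoint id ∧ ⋃₀ P = H.vertexSet ∧ ∀ S ∈ P, HasCopyOn F H S

/-- The complete `k`-graph `K_r^{(k)}` on `r` vertices. -/
def completeUniform (k r : ℕ) : Hypergraph (Fin r) where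
  vertexSet := Set.univ
  edgeSet := {e | e.encard = k}
  subset_vertexSet_of_mem_edgeSet' := fun _ _ => Set.subset_univ _

end Hypergraph

/-! The proof is by absorption. Everything rests on an ordered form of discrepancy (`OrdDisc`), in
which the layout becomes predicates on tuples, the `j`-th ignoring coordinate `j`. Layouts only see
unordered sets, so positions are marked by a random colouring of the vertices; averaging over
colourings costs a factor `k ^ k` in the error (`DiscGE.ordered`).

Ordered discrepancy gives a counting lemma (`counting`). If constraints are imposed by increasing
size, no earlier one contains the new one, so each ignores some coordinate of the new one. Each
constraint therefore costs a factor `q` and an error `ε`. No linearity is needed, and edges may be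
mixed with link edges.

An absorber for `x_1, …, x_r` is an `r × (r - 1)` grid whose columns are cliques and whose rows
become cliques once `x_i` joins row `i`. The grid can thus be tiled with or without the `x_i`. By
counting, a positive proportion of grids absorb a given tuple (`card_isAbsorber`), and a greedy
choice yields disjoint grids containing many absorbers for every tuple (`exists_disjoint_family`).
Outside the grids, every set of linear size contains a clique (`exists_isCliqueSet_subset`), so
greedy tiling leaves a small remainder, whose size is divisible by `r`; the absorbers take it in `r`
vertices at a time. -/

open Finset in
/-- A map prescribed on the range of an injective tuple `z` has `k ^ (n - k)` extensions. -/
theorem card_colourings {W : Type*} [Fintype W] [DecidableEq W] {k : ℕ} (z : Fin k → W)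
    (hz : Function.Injective z) :
    #{c : W → Fin k | ∀ i, c (z i) = i} = k ^ (Fintype.card W - k) := by
  classical
  have h : ({c : W → Fin k | ∀ i, c (z i) = i} : Finset (W → Fin k)) =
      Fintype.piFinset (fun w => {i | ∀ j, z j = w → i = j}) := by
    ext c
    simp only [mem_filter, mem_univ, true_and, Fintype.mem_piFinset]
    exact ⟨fun h w j hj => by rw [← hj, h], fun h i => h _ i rfl⟩
  rw [h, Fintype.card_piFinset]
  have h2 : ∀ w, #{i : Fin k | ∀ j, z j = w → i = j} = if w ∈ univ.image z then 1 else k := by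
    intro w
    split_ifs with hw
    · obtain ⟨j, -, rfl⟩ := mem_image.1 hw
      rw [card_eq_one]
      refine ⟨j, ?_⟩
      ext i
      simp only [mem_filter, mem_univ, true_and, mem_singleton]
      exact ⟨fun h => h j rfl, fun h j' hj' => by rw [h, hz hj']⟩
    · rw [filter_true_of_mem, card_univ, Fintype.card_fin]
      intro i _ j hj
      exact (hw (mem_image.2 ⟨j, mem_univ _, hj⟩)).elim
  simp_rw [h2]
  rw [prod_ite, prod_const_one, one_mul, prod_const, filter_not, filter_mem_eq_inter, univ_inter,
    ← compl_eq_univ_sdiff, card_compl, card_image_of_injective _ hz, card_univ, Fintype.card_fin]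

namespace Hypergraph

open Finset

/-! ### Discrepancy for ordered tuples, by averaging over colourings. -/

section Ordered

variable {V : Type*} {G : Hypergraph V} {S : Set V} {k : ℕ}
  {P : Fin k → (Fin k → S) → Prop} {p μ : ℝ}

/-- The layout of properly coloured tuples satisfying the predicates `P j`. -/
def colourLayout (G : Hypergraph V) (P : Fin k → (Fin k → S) → Prop) (c : S → Fin k)
    (I : Finset (Fin k)) : Hypergraph V where
  vertexSet := G.vertexSet
  edgeSet := {T | ∃ z : Fin k → S, Function.Injective z ∧ (∀ i, (z i : V) ∈ G.vertexSet) ∧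
    (∀ i ∈ I, c (z i) = i) ∧ (∀ j ∉ I, P j z) ∧ T = (fun i => (z i : V)) '' I}
  subset_vertexSet_of_mem_edgeSet' := by
    rintro T ⟨z, -, hz, -, -, rfl⟩ v ⟨i, -, rfl⟩
    exact hz i

theorem isLayout_colourLayout (c : S → Fin k) (𝓘 : Finset (Finset (Fin k))) :
    G.IsLayout 𝓘 (colourLayout G P c) := by
  refine fun I _ => ⟨rfl, ?_⟩
  rintro T ⟨z, hz, -, -, -, rfl⟩
  have h : Function.Injective fun i => (z i : V) := Subtype.val_injective.comp hz
  rw [h.encard_image, Set.encard_coe_eq_coe_finsetCard]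

/-- Layout edges are unordered, but the colours of their vertices recover the positions. The witness
for the index set omitting `j` therefore agrees with the clique off `j`, and `P j` sees nothing
else. -/
theorem layoutCliques_colourLayout (hGS : G.vertexSet ⊆ S) (hk : 0 < k)
    (hP : ∀ j x y, (∀ i, i ≠ j → x i = y i) → P j x → P j y) (c : S → Fin k) :
    G.layoutCliques ((univ : Finset (Fin k)).powersetCard (k - 1)) (colourLayout G P c) =
      (fun (z : Fin k → S) i => (z i : V)) '' {z | (Function.Injective z ∧
        (∀ i, (z i : V) ∈ G.vertexSet) ∧ ∀ j, P j z) ∧ ∀ i, c (z i) = i} := by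
  have hI : ∀ I : Finset (Fin k), I ∈ (univ : Finset (Fin k)).powersetCard (k - 1) ↔
      ∃ j, I = univ.erase j := by
    intro I
    rw [mem_powersetCard]
    constructor
    · rintro ⟨-, hI⟩
      have : #(Iᶜ) = 1 := by rw [card_compl, Fintype.card_fin, hI]; omega
      obtain ⟨j, hj⟩ := card_eq_one.1 this
      refine ⟨j, ?_⟩
      rw [← compl_compl I, hj]; ext; simp
    · rintro ⟨j, rfl⟩
      exact ⟨subset_univ _, by rw [card_erase_of_mem (mem_univ j), card_univ, Fintype.card_fin]⟩
  ext x
  constructor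
  · rintro ⟨hx, hxV, hxI⟩
    have key : ∀ j, ∃ z : Fin k → S, P j z ∧ (∀ i, i ≠ j → c (z i) = i) ∧
        ∀ i, i ≠ j → ∃ i', i' ≠ j ∧ (z i' : V) = x i := by
      intro j
      obtain ⟨z, -, -, hzc, hzP, hz⟩ := hxI (univ.erase j) ((hI _).2 ⟨j, rfl⟩)
      refine ⟨z, hzP j (by simp), fun i hi => hzc i (by simp [hi]), fun i hi => ?_⟩
      have : x i ∈ x '' ((univ.erase j : Finset (Fin k)) : Set (Fin k)) :=
        ⟨i, by simp [hi], rfl⟩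
      rw [hz] at this
      obtain ⟨i', hi', h⟩ := this
      exact ⟨i', by simpa using hi', h⟩
    let y : Fin k → S := fun i => ⟨x i, hGS (hxV i)⟩
    -- If position `i` had a colour `j ≠ i`, its vertex would lie in the edge indexed by the
    -- complement of `j`, where colour `j` does not occur.
    have hyc : ∀ i, c (y i) = i := by
      intro i
      by_contra hne
      obtain ⟨z, -, hzc, hz⟩ := key (c (y i))
      obtain ⟨i', hi', h⟩ := hz i (Ne.symm hne)
      have : z i' = y i := Subtype.ext h
      exact hi' (by rw [← this, hzc i' hi'])
    refine ⟨y, ⟨⟨fun i i' h => hx (congrArg Subtype.val h), hxV, fun j => ?_⟩, hyc⟩, rfl⟩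
    obtain ⟨z, hzP, hzc, hz⟩ := key j
    refine hP j z y (fun i hi => ?_) hzP
    obtain ⟨i', hi', h⟩ := hz i hi
    have h' : z i' = y i := Subtype.ext h
    have : i' = i := by rw [← hzc i' hi', h', hyc i]
    rw [← h', this]
  · rintro ⟨z, ⟨⟨hz, hzV, hzP⟩, hzc⟩, rfl⟩
    refine ⟨Subtype.val_injective.comp hz, hzV, fun I hI' => ?_⟩
    exact ⟨z, hz, hzV, fun i _ => hzc i, fun j _ => hzP j, rfl⟩

open Classical in
/-- Discrepancy for layouts of ordered tuples, obtained by averaging over all colourings. -/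
theorem DiscGE.ordered [Fintype S] (hG : G.DiscGE ((univ : Finset (Fin k)).powersetCard (k - 1)) p μ)
    (hGS : G.vertexSet ⊆ S) (hk : 0 < k) (hμ : 0 ≤ μ)
    (hP : ∀ j x y, (∀ i, i ≠ j → x i = y i) → P j x → P j y) :
    p * #{z : Fin k → S | Function.Injective z ∧ (∀ i, (z i : V) ∈ G.vertexSet) ∧ ∀ j, P j z} -
      μ * (k : ℝ) ^ k * (Fintype.card S : ℝ) ^ k ≤
    #{z : Fin k → S | (Function.Injective z ∧ (∀ i, (z i : V) ∈ G.vertexSet) ∧ ∀ j, P j z) ∧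
      Set.range (fun i => (z i : V)) ∈ G.edgeSet} := by
  set good : (Fin k → S) → Prop := fun z =>
    Function.Injective z ∧ (∀ i, (z i : V) ∈ G.vertexSet) ∧ ∀ j, P j z
  set edge : (Fin k → S) → Prop := fun z => Set.range (fun i => (z i : V)) ∈ G.edgeSet
  change p * #{z | good z} - _ ≤ (#{z | good z ∧ edge z} : ℝ)
  -- Without good tuples the bound is trivial. Otherwise injectivity gives `k ≤ |S|`, so the
  -- exponent `|S| - k` below is not truncated.
  rcases eq_or_ne (#{z | good z}) 0 with h0 | h0
  · rw [h0]
    have : 0 ≤ μ * (k : ℝ) ^ k * (Fintype.card S : ℝ) ^ k := by positivity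
    have h2 : (0 : ℝ) ≤ #{z | good z ∧ edge z} := by positivity
    simp only [Nat.cast_zero, mul_zero, zero_sub]
    linarith
  have hkn : k ≤ Fintype.card S := by
    obtain ⟨z, hz⟩ := card_pos.1 (Nat.pos_of_ne_zero h0)
    simpa using Fintype.card_le_of_injective z (mem_filter.1 hz).2.1
  have hinj : Function.Injective (fun (z : Fin k → S) i => (z i : V)) := fun z z' h =>
    funext fun i => Subtype.ext (congrFun h i)
  have hcol : ∀ c : S → Fin k, p * #{z | good z ∧ ∀ i, c (z i) = i} -
      μ * (Fintype.card S : ℝ) ^ k ≤ #{z | (good z ∧ edge z) ∧ ∀ i, c (z i) = i} := by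
    intro c
    have h := hG (colourLayout G P c) (isLayout_colourLayout c _)
    have h1 : (G.layoutCliques ((univ : Finset (Fin k)).powersetCard (k - 1))
        (colourLayout G P c)).ncard = #{z | good z ∧ ∀ i, c (z i) = i} := by
      rw [layoutCliques_colourLayout hGS hk hP, Set.ncard_image_of_injective _ hinj,
        ← Set.ncard_coe_finset]
      congr 1
      ext z; simp [good]
    have h2 : ({x ∈ G.layoutCliques ((univ : Finset (Fin k)).powersetCard (k - 1))
        (colourLayout G P c) | Set.range x ∈ G.edgeSet}).ncard =
        #{z | (good z ∧ edge z) ∧ ∀ i, c (z i) = i} := by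
      rw [layoutCliques_colourLayout hGS hk hP, ← Set.ncard_coe_finset,
        ← Set.ncard_image_of_injective _ hinj]
      congr 1
      ext x
      constructor
      · rintro ⟨⟨z, hz, rfl⟩, hx⟩
        exact ⟨z, by simpa using ⟨⟨hz.1, hx⟩, hz.2⟩, rfl⟩
      · rintro ⟨z, hz, rfl⟩
        have hz : (good z ∧ edge z) ∧ ∀ i, c (z i) = i := by simpa using hz
        exact ⟨⟨z, ⟨hz.1.1, hz.2⟩, rfl⟩, hz.1.2⟩
    rw [h1, h2] at h
    have h3 : (G.vertexSet.ncard : ℝ) ≤ Fintype.card S := by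
      rw [← Nat.card_eq_fintype_card, Nat.card_coe_set_eq]
      exact_mod_cast Set.ncard_le_ncard hGS S.toFinite
    have h4 : μ * (G.vertexSet.ncard : ℝ) ^ k ≤ μ * (Fintype.card S : ℝ) ^ k := by gcongr
    linarith
  have hsum : ∀ R : (Fin k → S) → Prop, (∀ z, R z → Function.Injective z) →
      ∑ c : S → Fin k, (#{z | R z ∧ ∀ i, c (z i) = i} : ℝ) =
        #{z | R z} * (k : ℝ) ^ (Fintype.card S - k) := by
    intro R hR
    have : ∑ c : S → Fin k, #{z | R z ∧ ∀ i, c (z i) = i} =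
        #{z | R z} * k ^ (Fintype.card S - k) := by
      have h := sum_card_bipartiteAbove_eq_sum_card_bipartiteBelow
        (s := (univ : Finset (S → Fin k))) (t := ({z | R z} : Finset (Fin k → S)))
        (fun c z => ∀ i, c (z i) = i)
      simp only [bipartiteAbove, bipartiteBelow, filter_filter] at h
      rw [h, sum_congr rfl (fun z hz => card_colourings z (hR z (mem_filter.1 hz).2)), sum_const,
        smul_eq_mul]
    exact_mod_cast this
  have h := sum_le_sum fun c (_ : c ∈ (univ : Finset (S → Fin k))) => hcol c
  have hsum1 : ∑ c : S → Fin k, (#{z | good z ∧ ∀ i, c (z i) = i} : ℝ) =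
      #{z | good z} * (k : ℝ) ^ (Fintype.card S - k) := by
    convert hsum good fun z hz => hz.1
  have hsum2 : ∑ c : S → Fin k, (#{z | (good z ∧ edge z) ∧ ∀ i, c (z i) = i} : ℝ) =
      #{z | good z ∧ edge z} * (k : ℝ) ^ (Fintype.card S - k) := by
    convert hsum (fun z => good z ∧ edge z) fun z hz => hz.1.1
  rw [sum_sub_distrib, ← mul_sum, hsum1, hsum2, sum_const,
    card_univ, Fintype.card_fun, Fintype.card_fin, nsmul_eq_mul] at h
  have hN : (0 : ℝ) < (k : ℝ) ^ (Fintype.card S - k) := by positivity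
  -- The error is paid for every colouring, while a tuple is seen by only a `k ^ (-k)` fraction of
  -- them; this is the source of the factor `k ^ k`.
  have hkN : (k : ℝ) ^ Fintype.card S = (k : ℝ) ^ k * (k : ℝ) ^ (Fintype.card S - k) := by
    rw [← pow_add]; congr 1; omega
  push_cast at h
  rw [hkN] at h
  refine le_of_mul_le_mul_right ?_ hN
  linarith

end Ordered

/-! ### Ordered discrepancy and the counting lemma. -/

open Classical in
/-- Ordered form of the discrepancy property for a family `𝓔` of finite subsets of `W`: among the
tuples satisfying predicates `P j`, where `P j` ignores the `j`-th coordinate, a proportion of at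
least `p` has its image in `𝓔`, up to an error `ε |W| ^ k`. -/
def OrdDisc {W : Type*} [Fintype W] [DecidableEq W] (k : ℕ) (𝓔 : Set (Finset W)) (p ε : ℝ) : Prop :=
  ∀ P : Fin k → (Fin k → W) → Prop,
    (∀ j x y, (∀ i, i ≠ j → x i = y i) → P j x → P j y) →
    p * #{x | ∀ j, P j x} - ε * (Fintype.card W : ℝ) ^ k ≤
      #{x | (∀ j, P j x) ∧ univ.image x ∈ 𝓔}

theorem OrdDisc.mono {W : Type*} [Fintype W] [DecidableEq W] {k : ℕ}
    {𝓔 𝓔' : Set (Finset W)} {p p' ε ε' : ℝ} (h : OrdDisc k 𝓔 p ε) (h𝓔 : 𝓔 ⊆ 𝓔') (hp : p' ≤ p)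
    (hε : ε ≤ ε') : OrdDisc k 𝓔' p' ε' := by
  classical
  intro P hP
  refine le_trans ?_ ((h P hP).trans ?_)
  · gcongr
  · gcongr

section Counting

variable {W ι : Type*} [Fintype W] [Fintype ι] [DecidableEq W] [DecidableEq ι]

/-- The tuples whose coordinate at `i` lies in `B` form a proportion `|B| / |W|`. -/
theorem card_filter_mem_mul (i : ι) (B : Finset W) :
    #{f : ι → W | f i ∈ B} * Fintype.card W = #B * Fintype.card W ^ Fintype.card ι := by
  have h : ({f : ι → W | f i ∈ B} : Finset (ι → W)) =
      Fintype.piFinset (fun j => if j = i then B else univ) := by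
    ext f
    simp only [mem_filter, mem_univ, true_and, Fintype.mem_piFinset]
    constructor
    · intro h j
      split_ifs with hj
      · rwa [hj]
      · exact mem_univ _
    · intro h; simpa using h i
  rw [h, Fintype.card_piFinset]
  have h2 : ∀ j, #(if j = i then B else (univ : Finset W)) =
      if j = i then #B else Fintype.card W := fun j => by split_ifs <;> simp
  simp_rw [h2]
  rw [prod_ite, prod_const, prod_const, filter_eq', if_pos (mem_univ i), card_singleton, pow_one,
    mul_assoc, ← pow_succ, filter_ne', card_erase_of_mem (mem_univ i), card_univ,
    Nat.sub_add_cancel (Fintype.card_pos_iff.2 ⟨i⟩)]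

theorem card_filter_exists_mem_mul_le (B : Finset W) :
    #{f : ι → W | ∃ i, f i ∈ B} * Fintype.card W ≤
      Fintype.card ι * #B * Fintype.card W ^ Fintype.card ι := by
  have h : ({f : ι → W | ∃ i, f i ∈ B} : Finset (ι → W)) ⊆
      univ.biUnion fun i => {f : ι → W | f i ∈ B} := by
    intro f; simp
  calc _ ≤ (∑ i : ι, #{f : ι → W | f i ∈ B}) * Fintype.card W :=
        Nat.mul_le_mul_right _ ((card_le_card h).trans card_biUnion_le)
    _ = _ := by
        rw [sum_mul, sum_congr rfl fun i _ => card_filter_mem_mul i B, sum_const, card_univ,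
          smul_eq_mul, mul_assoc]

/-- Coordinate `i` is determined by coordinate `j`, so overwriting it with a free value gives a
bijection onto all tuples. -/
theorem card_filter_eq_mul (i j : ι) (hij : i ≠ j) :
    #{f : ι → W | f i = f j} * Fintype.card W = Fintype.card W ^ Fintype.card ι := by
  rw [← card_univ, ← card_product, card_univ, ← Fintype.card_fun, ← card_univ]
  refine card_bij' (fun a _ => Function.update a.1 i a.2)
    (fun f _ => (Function.update f i (f j), f i)) ?_ ?_ ?_ ?_
  · simp
  · intro f _
    simp [hij.symm]
  · rintro ⟨f, w⟩ hf
    simp only [mem_product, mem_filter, mem_univ, true_and, and_true] at hf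
    simp [hij.symm, ← hf]
  · intro f _
    simp

theorem card_filter_not_injective_mul_le :
    #{f : ι → W | ¬ Function.Injective f} * Fintype.card W ≤
      Fintype.card ι ^ 2 * Fintype.card W ^ Fintype.card ι := by
  have h : ({f : ι → W | ¬ Function.Injective f} : Finset (ι → W)) ⊆
      (univ : Finset ι).offDiag.biUnion fun q => {f : ι → W | f q.1 = f q.2} := by
    intro f hf
    simp only [Function.Injective, mem_filter, mem_univ, true_and, not_forall] at hf
    obtain ⟨i, j, hf, hij⟩ := hf
    exact mem_biUnion.2 ⟨(i, j), by simpa using hij, by simpa using hf⟩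
  calc _ ≤ (∑ q ∈ (univ : Finset ι).offDiag, #{f : ι → W | f q.1 = f q.2}) * Fintype.card W :=
        Nat.mul_le_mul_right _ ((card_le_card h).trans card_biUnion_le)
    _ = #(univ : Finset ι).offDiag * Fintype.card W ^ Fintype.card ι := by
        rw [sum_mul, sum_congr rfl fun q hq => card_filter_eq_mul q.1 q.2 (mem_offDiag.1 hq).2.2,
          sum_const, smul_eq_mul]
    _ ≤ _ := by
        refine Nat.mul_le_mul_right _ ?_
        rw [offDiag_card, card_univ, sq]
        exact Nat.sub_le _ _

open Classical in
/-- One further edge constraint on `e` multiplies the number of tuples by at least `p`, as long as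
each of the other constraints ignores some coordinate of `e`. -/
theorem OrdDisc.step {e : Finset ι} {𝓔 : Set (Finset W)} {p ε : ℝ} (h : OrdDisc #e 𝓔 p ε)
    (Q : ι → (ι → W) → Prop)
    (hQ : ∀ i ∈ e, ∀ f g : ι → W, (∀ i', i' ≠ i → f i' = g i') → Q i f → Q i g) :
    p * #{f : ι → W | ∀ i ∈ e, Q i f} - ε * (Fintype.card W : ℝ) ^ Fintype.card ι ≤
      #{f : ι → W | (∀ i ∈ e, Q i f) ∧ e.image f ∈ 𝓔} := by
  -- The coordinates outside `e` are frozen to `y`. Discrepancy applies to the remaining `#e`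
  -- coordinates for each `y`, and the bounds are summed.
  let Φ : (ι → W) ≃ (Fin #e → W) × ({i // i ∉ e} → W) :=
    (Equiv.piEquivPiSubtypeProd (fun i => i ∈ e) (fun _ => W)).trans
      (Equiv.prodCongr (Equiv.arrowCongr e.equivFin (Equiv.refl W)) (Equiv.refl _))
  have hΦ1 : ∀ x y (i : Fin #e), Φ.symm (x, y) (e.equivFin.symm i) = x i := by
    intro x y i
    simp [Φ, Equiv.piEquivPiSubtypeProd]
  have hΦ2 : ∀ x y (i : ι) (hi : i ∉ e), Φ.symm (x, y) i = y ⟨i, hi⟩ := by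
    intro x y i hi
    simp [Φ, Equiv.piEquivPiSubtypeProd, hi]
  have hcount : ∀ R : (ι → W) → Prop,
      (#{f : ι → W | R f} : ℝ) = ∑ y, (#{x : Fin #e → W | R (Φ.symm (x, y))} : ℝ) := by
    intro R
    simp only [card_filter, Nat.cast_sum]
    rw [← Fintype.sum_prod_type_right' (f := fun x y => ((if R (Φ.symm (x, y)) then 1 else 0 : ℕ) : ℝ))]
    exact Fintype.sum_equiv Φ _ _ fun f => by simp
  have hall : ∀ f : ι → W, (∀ i ∈ e, Q i f) ↔ ∀ j : Fin #e, Q (e.equivFin.symm j) f := by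
    intro f
    refine ⟨fun h j => h _ (e.equivFin.symm j).2, fun h i hi => ?_⟩
    simpa using h (e.equivFin ⟨i, hi⟩)
  have himage : ∀ x y, e.image (Φ.symm (x, y)) = univ.image x := by
    intro x y
    ext w
    simp only [mem_image, mem_univ, true_and]
    constructor
    · rintro ⟨i, hi, rfl⟩
      refine ⟨e.equivFin ⟨i, hi⟩, ?_⟩
      rw [← hΦ1 x y]; simp
    · rintro ⟨j, rfl⟩
      exact ⟨_, (e.equivFin.symm j).2, hΦ1 x y j⟩
  have hy : ∀ y, p * (#{x : Fin #e → W | ∀ j, Q (e.equivFin.symm j) (Φ.symm (x, y))} : ℝ) -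
      ε * (Fintype.card W : ℝ) ^ #e ≤
      #{x : Fin #e → W | (∀ j, Q (e.equivFin.symm j) (Φ.symm (x, y))) ∧ univ.image x ∈ 𝓔} := by
    intro y
    refine h (fun j x => Q (e.equivFin.symm j) (Φ.symm (x, y))) fun j x x' hx => ?_
    refine hQ _ (e.equivFin.symm j).2 _ _ fun i hi => ?_
    by_cases hie : i ∈ e
    · have h1 := hΦ1 x y (e.equivFin ⟨i, hie⟩)
      have h2 := hΦ1 x' y (e.equivFin ⟨i, hie⟩)
      simp only [Equiv.symm_apply_apply] at h1 h2
      rw [h1, h2]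
      refine hx _ fun hj => hi ?_
      rw [← hj]; simp
    · rw [hΦ2 _ _ _ hie, hΦ2 _ _ _ hie]
  have hsum := sum_le_sum fun y (_ : y ∈ (univ : Finset ({i // i ∉ e} → W))) => hy y
  have h1 : (#{f : ι → W | ∀ i ∈ e, Q i f} : ℝ) =
      ∑ y, (#{x : Fin #e → W | ∀ j, Q (e.equivFin.symm j) (Φ.symm (x, y))} : ℝ) := by
    have := hcount fun f => ∀ i ∈ e, Q i f
    simp only [hall] at this ⊢
    convert this
  have h2 : (#{f : ι → W | (∀ i ∈ e, Q i f) ∧ e.image f ∈ 𝓔} : ℝ) =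
      ∑ y, (#{x : Fin #e → W | (∀ j, Q (e.equivFin.symm j) (Φ.symm (x, y))) ∧
        univ.image x ∈ 𝓔} : ℝ) := by
    have := hcount fun f => (∀ i ∈ e, Q i f) ∧ e.image f ∈ 𝓔
    simp only [hall, himage] at this ⊢
    convert this
  rw [h1, h2]
  refine le_trans (le_of_eq ?_) hsum
  rw [sum_sub_distrib, ← mul_sum, sum_const, card_univ, Fintype.card_fun, nsmul_eq_mul]
  have : Fintype.card ι = Fintype.card {i // i ∉ e} + #e := by
    rw [Fintype.card_subtype_compl, Fintype.card_coe, Nat.sub_add_cancel (card_le_univ e)]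
  rw [this, pow_add]
  push_cast
  ring

open Classical in
/-- The counting lemma: the number of tuples with entries in `U` that map each `e ∈ 𝓢` to a member
of `𝓔 e`. -/
theorem counting {𝓔 : Finset ι → Set (Finset W)} {q ε : ℝ} (hq0 : 0 ≤ q) (hq1 : q ≤ 1)
    (hε : 0 ≤ ε) (U : Finset W) (𝓢 : Finset (Finset ι))
    (hU : U = univ ∨ ∀ e ∈ 𝓢, 2 ≤ #e) (h𝓔 : ∀ e ∈ 𝓢, OrdDisc #e (𝓔 e) q ε) :
    q ^ #𝓢 * (#U : ℝ) ^ Fintype.card ι - #𝓢 * ε * (Fintype.card W : ℝ) ^ Fintype.card ι ≤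
      #{f : ι → W | (∀ i, f i ∈ U) ∧ ∀ e ∈ 𝓢, e.image f ∈ 𝓔 e} := by
  induction 𝓢 using Finset.induction_on_max_value (fun e : Finset ι => #e) with
  | empty =>
    have : ({f : ι → W | ∀ i, f i ∈ U} : Finset (ι → W)) = Fintype.piFinset fun _ => U := by
      ext f; simp
    simp [this, Fintype.card_piFinset]
  | insert e 𝓢 he hmax ih =>
    specialize ih (hU.imp_right fun h e' he' => h e' (mem_insert_of_mem he'))
      fun e' he' => h𝓔 e' (mem_insert_of_mem he')
    -- `Q i` collects what does not look at coordinate `i`. Over `i ∈ e` this recovers all earlier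
    -- constraints, since an `e' ≠ e` that is no larger misses a point of `e`. Membership of `f i'`
    -- in `U` comes from any `i ∈ e` other than `i'`, hence the need for `2 ≤ #e` when `U` is
    -- proper.
    let Q : ι → (ι → W) → Prop := fun i f =>
      (U = univ ∨ ∀ i', i' ≠ i → f i' ∈ U) ∧ ∀ e' ∈ 𝓢, i ∉ e' → e'.image f ∈ 𝓔 e'
    have hQ : ∀ i ∈ e, ∀ f g : ι → W, (∀ i', i' ≠ i → f i' = g i') → Q i f → Q i g := by
      rintro i - f g hfg ⟨h1, h2⟩
      refine ⟨h1.imp_right fun h i' hi' => hfg i' hi' ▸ h i' hi', fun e' he' hi => ?_⟩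
      have : e'.image g = e'.image f :=
        image_congr fun i' hi' => (hfg i' fun h => hi (by simpa [h] using hi')).symm
      rw [this]
      exact h2 e' he' hi
    have hall : ∀ f, (∀ i ∈ e, Q i f) ↔ (∀ i, f i ∈ U) ∧ ∀ e' ∈ 𝓢, e'.image f ∈ 𝓔 e' := by
      intro f
      constructor
      · intro h
        constructor
        · intro i'
          rcases hU with rfl | hU
          · exact mem_univ _
          · obtain ⟨i, hi, hii'⟩ := exists_mem_ne (hU e (mem_insert_self _ _)) i'
            rcases (h i hi).1 with rfl | h
            · exact mem_univ _
            · exact h i' hii'.symm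
        · intro e' he'
          have : ¬ e ⊆ e' := fun hsub => he (eq_of_subset_of_card_le hsub (hmax e' he') ▸ he')
          obtain ⟨i, hi, hi'⟩ := not_subset.1 this
          exact (h i hi).2 e' he' hi'
      · rintro ⟨h1, h2⟩ i -
        exact ⟨Or.inr fun i' _ => h1 i', fun e' he' _ => h2 e' he'⟩
    have hstep := (h𝓔 e (mem_insert_self _ _)).step Q hQ
    simp only [hall] at hstep
    have hiff : ∀ f : ι → W, (∀ i, f i ∈ U) ∧ (∀ e' ∈ insert e 𝓢, e'.image f ∈ 𝓔 e') ↔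
        ((∀ i, f i ∈ U) ∧ ∀ e' ∈ 𝓢, e'.image f ∈ 𝓔 e') ∧ e.image f ∈ 𝓔 e := by
      intro f
      rw [forall_mem_insert]; tauto
    simp only [hiff]
    refine le_trans ?_ hstep
    rw [card_insert_of_notMem he, pow_succ]
    push_cast
    have h1 := mul_le_mul_of_nonneg_left ih hq0
    have h2 : q * (#𝓢 * ε * (Fintype.card W : ℝ) ^ Fintype.card ι) ≤
        #𝓢 * ε * (Fintype.card W : ℝ) ^ Fintype.card ι :=
      mul_le_of_le_one_left (by positivity) hq1
    linarith

open Classical in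
/-- The counting lemma, with the counted tuples collected in a finset. -/
theorem exists_counting {𝓔 : Finset ι → Set (Finset W)} {q ε : ℝ} (hq0 : 0 ≤ q) (hq1 : q ≤ 1)
    (hε : 0 ≤ ε) (U : Finset W) (𝓢 : Finset (Finset ι))
    (hU : U = univ ∨ ∀ e ∈ 𝓢, 2 ≤ #e) (h𝓔 : ∀ e ∈ 𝓢, OrdDisc #e (𝓔 e) q ε) :
    ∃ A : Finset (ι → W), (∀ f ∈ A, (∀ i, f i ∈ U) ∧ ∀ e ∈ 𝓢, e.image f ∈ 𝓔 e) ∧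
      q ^ #𝓢 * (#U : ℝ) ^ Fintype.card ι - #𝓢 * ε * (Fintype.card W : ℝ) ^ Fintype.card ι ≤ #A :=
  ⟨_, fun _ hf => (mem_filter.1 hf).2, counting hq0 hq1 hε U 𝓢 hU h𝓔⟩

end Counting

/-! ### Tilings, absorption and the greedy choice of a disjoint family. -/

section Tiling

variable {W : Type*} [DecidableEq W]

/-- `Tiled C S`: the finite set `S` can be partitioned into sets satisfying `C`. -/
inductive Tiled (C : Finset W → Prop) : Finset W → Prop
  | empty : Tiled C ∅
  | tile_union {S T : Finset W} : C S → Tiled C T → Disjoint S T → Tiled C (S ∪ T)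

variable {C : Finset W → Prop}

theorem Tiled.union {S T : Finset W} (hS : Tiled C S) (hT : Tiled C T) (h : Disjoint S T) :
    Tiled C (S ∪ T) := by
  induction hS with
  | empty => simpa using hT
  | tile_union hC _ hd ih =>
    rw [disjoint_union_left] at h
    rw [union_assoc]
    exact .tile_union hC (ih h.2) (disjoint_union_right.2 ⟨hd, h.1⟩)

theorem Tiled.of_tile {S : Finset W} (hS : C S) : Tiled C S := by
  simpa using Tiled.tile_union hS .empty (disjoint_empty_right S)

theorem Tiled.biUnion {T : Type*} {s : Finset T} {g : T → Finset W} (hC : ∀ a ∈ s, Tiled C (g a))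
    (hd : (s : Set T).PairwiseDisjoint g) : Tiled C (s.biUnion g) := by
  classical
  induction s using Finset.induction_on with
  | empty => exact .empty
  | insert a s ha ih =>
    rw [biUnion_insert]
    refine (hC a (mem_insert_self _ _)).union (ih (fun b hb => hC b (mem_insert_of_mem hb))
      (hd.subset (by simp))) ?_
    rw [disjoint_biUnion_right]
    intro b hb
    exact hd (by simp) (by simp [hb]) fun h => ha (h ▸ hb)

theorem Tiled.dvd_card {r : ℕ} (hr : ∀ S, C S → #S = r) {S : Finset W} (hS : Tiled C S) :
    r ∣ #S := by
  induction hS with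
  | empty => simp
  | tile_union hC _ hd ih =>
    rw [card_union_of_disjoint hd, hr _ hC]
    exact (Nat.dvd_refl r).add ih

theorem Tiled.exists_partition {S : Finset W} (hS : Tiled C S) :
    ∃ P : Set (Finset W), P.PairwiseDisjoint id ∧ (∀ w, w ∈ S ↔ ∃ T ∈ P, w ∈ T) ∧
      ∀ T ∈ P, C T := by
  induction hS with
  | empty => exact ⟨∅, by simp, by simp, by simp⟩
  | @tile_union S T hC _ hd ih =>
    obtain ⟨P, hP, hPT, hPC⟩ := ih
    refine ⟨insert S P, ?_, ?_, ?_⟩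
    · refine hP.insert fun R hR _ => ?_
      refine hd.mono_right fun w hw => (hPT w).2 ⟨R, hR, hw⟩
    · intro w
      simp [hPT]
    · rintro R (rfl | hR)
      exacts [hC, hPC R hR]

/-- Removing tiles greedily from `U` until fewer than `t` elements are left. -/
theorem exists_tiled_subset {t : ℕ} (hne : ¬ C ∅)
    (h : ∀ U : Finset W, t ≤ #U → ∃ S ⊆ U, C S) (U : Finset W) :
    ∃ T ⊆ U, Tiled C T ∧ #(U \ T) < t := by
  induction U using Finset.strongInduction with
  | H U ih =>
    rcases lt_or_ge #U t with hU | hU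
    · exact ⟨∅, empty_subset _, .empty, by simpa using hU⟩
    · obtain ⟨S, hSU, hS⟩ := h U hU
      have hSne : S.Nonempty := nonempty_iff_ne_empty.2 fun h => hne (h ▸ hS)
      obtain ⟨T, hT, hTt, hcard⟩ := ih (U \ S) (sdiff_ssubset hSU hSne)
      refine ⟨S ∪ T, union_subset hSU (hT.trans sdiff_subset), .tile_union hS hTt ?_, ?_⟩
      · exact disjoint_of_subset_right hT disjoint_sdiff
      · rwa [sdiff_sdiff_left, sup_eq_union] at hcard

/-- A family of disjoint tiled sets absorbs a set `L` of `r * s` elements if every `r`-subset of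
`L` is absorbed by at least `s` members of the family. -/
theorem tiled_union_biUnion_of_absorbing {T : Type*} [DecidableEq T] {g : T → Finset W} {r : ℕ}
    (R : Finset W → T → Prop) [∀ X a, Decidable (R X a)] (s : ℕ) :
    ∀ (𝓕 : Finset T) (L : Finset W), (∀ a ∈ 𝓕, Tiled C (g a)) →
      (𝓕 : Set T).PairwiseDisjoint g → #L = r * s → Disjoint L (𝓕.biUnion g) →
      (∀ X a, R X a → Tiled C (X ∪ g a)) →
      (∀ X ⊆ L, #X = r → s ≤ #{a ∈ 𝓕 | R X a}) → Tiled C (L ∪ 𝓕.biUnion g) := by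
  induction s with
  | zero =>
    intro 𝓕 L h𝓕 hd hL _ _ _
    rw [mul_zero, card_eq_zero] at hL
    rw [hL, empty_union]
    exact .biUnion h𝓕 hd
  | succ s ih =>
    intro 𝓕 L h𝓕 hd hL hLd hR hX
    -- One member absorbs `X` and is removed. This lowers every count by at most one, in step with
    -- the passage from `s + 1` to `s`.
    obtain ⟨X, hXL, hXr⟩ := exists_subset_card_eq (s := L) (n := r) (by rw [hL]; nlinarith)
    obtain ⟨a, ha⟩ := card_pos.1 (lt_of_lt_of_le (Nat.succ_pos s) (hX X hXL hXr))
    obtain ⟨ha, haX⟩ := mem_filter.1 ha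
    have h := ih (𝓕.erase a) (L \ X) (fun b hb => h𝓕 b (mem_of_mem_erase hb))
      (hd.subset (by simp)) (by rw [card_sdiff_of_subset hXL, hL, hXr]; ring_nf; omega)
      (disjoint_of_subset_left sdiff_subset
        (disjoint_of_subset_right (biUnion_subset_biUnion_of_subset_left _ (erase_subset _ _)) hLd))
      hR fun Y hY hYr => by
        have := hX Y (hY.trans sdiff_subset) hYr
        rw [filter_erase]
        exact (Nat.sub_le_sub_right this 1).trans pred_card_le_card_erase
    rw [disjoint_biUnion_right] at hLd
    have hdisj : Disjoint (X ∪ g a) (L \ X ∪ (𝓕.erase a).biUnion g) := by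
      rw [disjoint_union_left, disjoint_union_right, disjoint_union_right, disjoint_biUnion_right,
        disjoint_biUnion_right]
      refine ⟨⟨disjoint_sdiff, fun b hb => ?_⟩, ?_, fun b hb => ?_⟩
      · exact disjoint_of_subset_left hXL (hLd b (mem_of_mem_erase hb))
      · exact (disjoint_of_subset_left sdiff_subset (hLd a ha)).symm
      · exact hd ha (mem_of_mem_erase hb) (ne_of_mem_erase hb).symm
    have heq : L ∪ 𝓕.biUnion g = (X ∪ g a) ∪ (L \ X ∪ (𝓕.erase a).biUnion g) := by
      rw [← insert_erase ha, biUnion_insert, erase_insert_eq_erase, erase_idem]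
      nth_rewrite 1 [← union_sdiff_of_subset hXL]
      ac_rfl
    rw [heq]
    exact (hR X a haX).union h hdisj

open Classical in
/-- If every `x` is related to a positive proportion of the candidates, also when a small set is
to be avoided, then there is a family of `m` disjoint good candidates such that
every `x` is related to many of them. The choice is greedy for the potential
`∑ x, 2 ^ (-number of members related to x)`. -/
theorem exists_disjoint_family {X T : Type*} [Fintype X] [Fintype T] [Nonempty X] [Nonempty T]
    {R : X → T → Prop} {good : T → Prop} {g : T → Finset W} {s b : ℕ} {c : ℝ} (hc0 : 0 < c)
    (hR : ∀ x a, R x a → good a) (hs : ∀ a, #(g a) ≤ s) (hne : ∀ a, (g a).Nonempty)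
    (hc : ∀ x (B : Finset W), #B ≤ b →
      c * Fintype.card T ≤ #{a | R x a ∧ Disjoint (g a) B}) (m : ℕ) (hm : m * s ≤ b) :
    ∃ 𝓕 : Finset T, #(𝓕.biUnion g) ≤ m * s ∧ (∀ a ∈ 𝓕, good a) ∧
      (𝓕 : Set T).PairwiseDisjoint g ∧
      ∑ x, (1 / 2 : ℝ) ^ #{a ∈ 𝓕 | R x a} ≤ Fintype.card X * (1 - c / 2) ^ m := by
  induction m with
  | zero => exact ⟨∅, by simp, by simp, by simp, by simp⟩
  | succ m ih =>
    have hm' : m * s ≤ b := by nlinarith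
    obtain ⟨𝓕, hcard, hgood, hd, hpot⟩ := ih hm'
    set B := 𝓕.biUnion g with hB
    have hcB := fun x => hc x B (hcard.trans hm')
    set A : Finset T := {a | good a ∧ Disjoint (g a) B} with hA
    have hcA : ∀ x, c * #A ≤ #{a ∈ A | R x a} := by
      intro x
      refine le_trans ?_ ((hcB x).trans ?_)
      · gcongr; exact card_le_univ A
      · norm_cast
        refine card_le_card fun a ha => ?_
        simp only [hA, mem_filter, mem_univ, true_and] at ha ⊢
        exact ⟨⟨hR x a ha.1, ha.2⟩, ha.1⟩
    have hAne : A.Nonempty := by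
      obtain ⟨x⟩ := ‹Nonempty X›
      have h1 := hcB x
      have : (0 : ℝ) < c * Fintype.card T := mul_pos hc0 (by exact_mod_cast Fintype.card_pos)
      have h2 : 0 < #{a | R x a ∧ Disjoint (g a) B} := by exact_mod_cast this.trans_le h1
      obtain ⟨a, ha⟩ := card_pos.1 h2
      simp only [mem_filter, mem_univ, true_and] at ha
      exact ⟨a, by simpa [hA] using ⟨hR x a ha.1, ha.2⟩⟩
    have hnot : ∀ a ∈ A, a ∉ 𝓕 := by
      intro a ha h
      have h1 : Disjoint (g a) B := (mem_filter.1 ha).2.2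
      have h2 : g a ⊆ B := subset_biUnion_of_mem g h
      exact (hne a).ne_empty (disjoint_self.1 (disjoint_of_subset_right h2 h1))
    have hins : ∀ x, ∀ a ∈ A, (1 / 2 : ℝ) ^ #{a' ∈ insert a 𝓕 | R x a'} =
        (1 / 2 : ℝ) ^ #{a' ∈ 𝓕 | R x a'} * (1 - if R x a then 1 / 2 else 0) := by
      intro x a ha
      rw [filter_insert]
      split_ifs with h
      · rw [card_insert_of_notMem fun h' => hnot a ha (mem_of_mem_filter a h'), pow_succ]
        norm_num
      · simp
    -- Adding `a` halves the term of each `x` related to `a`. Each `x` is related to at least a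
    -- fraction `c` of `A`, so the potential drops on average by the factor `1 - c / 2`.
    have hsum : ∑ a ∈ A, ∑ x, (1 / 2 : ℝ) ^ #{a' ∈ insert a 𝓕 | R x a'} ≤
        ∑ a ∈ A, Fintype.card X * (1 - c / 2) ^ (m + 1) := by
      rw [sum_comm, sum_const, nsmul_eq_mul]
      calc ∑ x, ∑ a ∈ A, (1 / 2 : ℝ) ^ #{a' ∈ insert a 𝓕 | R x a'}
          ≤ ∑ x, (1 / 2 : ℝ) ^ #{a' ∈ 𝓕 | R x a'} * (#A * (1 - c / 2)) := by
            refine sum_le_sum fun x _ => ?_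
            rw [sum_congr rfl (hins x), ← mul_sum, sum_sub_distrib, sum_const, nsmul_eq_mul,
              ← sum_filter, sum_const, nsmul_eq_mul]
            gcongr
            linarith [hcA x]
        _ = #A * (1 - c / 2) * ∑ x, (1 / 2 : ℝ) ^ #{a' ∈ 𝓕 | R x a'} := by
            rw [← sum_mul, mul_comm]
        _ ≤ #A * (1 - c / 2) * (Fintype.card X * (1 - c / 2) ^ m) := by
            refine mul_le_mul_of_nonneg_left hpot ?_
            obtain ⟨x⟩ := ‹Nonempty X›
            have h1 : (#{a ∈ A | R x a} : ℝ) ≤ #A := by exact_mod_cast card_filter_le _ _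
            nlinarith [hcA x, (by positivity : (0 : ℝ) ≤ #A)]
        _ = _ := by rw [pow_succ]; ring
    obtain ⟨a, ha, hle⟩ := exists_le_of_sum_le hAne hsum
    have hd' : Disjoint (g a) B := (mem_filter.1 ha).2.2
    refine ⟨insert a 𝓕, ?_, ?_, ?_, hle⟩
    · rw [biUnion_insert]
      calc _ ≤ #(g a) + #B := card_union_le _ _
        _ ≤ s + m * s := add_le_add (hs a) hcard
        _ = _ := by ring
    · intro a' ha'
      rcases mem_insert.1 ha' with rfl | h
      exacts [(mem_filter.1 ha).2.1, hgood _ h]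
    · rw [coe_insert]
      refine hd.insert fun a' ha' _ => ?_
      exact disjoint_of_subset_right (subset_biUnion_of_mem g ha') hd'

end Tiling

/-! ### Passage from hypergraphs to families of finite sets. -/

/-- The edges of `G` with all vertices in `S`, as finite subsets of the subtype `S`. -/
def edgesOn {V : Type*} (G : Hypergraph V) (S : Set V) : Set (Finset S) :=
  {T | Subtype.val '' (T : Set S) ∈ G.edgeSet}

-- Non-injective tuples and tuples through a missing vertex are a fraction at most `(k ^ 2 + k) /
-- |S|` of all tuples. Allowing one missing vertex lets the link of `x` be treated on all of `V(H)`.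
open Classical in
theorem DiscGE.ordDisc {V : Type*} {G : Hypergraph V} {S : Set V} [Fintype S] {k : ℕ} {p μ : ℝ}
    (hG : G.DiscGE ((univ : Finset (Fin k)).powersetCard (k - 1)) p μ) (hGS : G.vertexSet ⊆ S)
    (hmiss : #{w : S | (w : V) ∉ G.vertexSet} ≤ 1) (hk : 0 < k) (hμ : 0 ≤ μ) (hp0 : 0 ≤ p)
    (hp1 : p ≤ 1) (hS : 0 < Fintype.card S) :
    OrdDisc k (G.edgesOn S) p (μ * (k : ℝ) ^ k + (k ^ 2 + k) / Fintype.card S) := by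
  intro P hP
  have h := hG.ordered hGS hk hμ hP
  have hn : (0 : ℝ) < Fintype.card S := by exact_mod_cast hS
  set B : Finset S := {w | (w : V) ∉ G.vertexSet} with hB
  have h1 : #{x : Fin k → S | ∀ j, P j x} ≤
      #{z : Fin k → S | Function.Injective z ∧ (∀ i, (z i : V) ∈ G.vertexSet) ∧ ∀ j, P j z} +
      #{z : Fin k → S | ¬ Function.Injective z} + #{z : Fin k → S | ∃ i, z i ∈ B} := by
    refine (card_le_card fun z hz => ?_).trans
      ((card_union_le _ _).trans (Nat.add_le_add_right (card_union_le _ _) _))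
    simp only [hB, mem_union, mem_filter, mem_univ, true_and] at hz ⊢
    by_cases h1 : Function.Injective z
    · by_cases h2 : ∃ i, (z i : V) ∉ G.vertexSet
      · exact Or.inr h2
      · push Not at h2
        exact Or.inl (Or.inl ⟨h1, h2, hz⟩)
    · exact Or.inl (Or.inr h1)
  have h2 : #{z : Fin k → S | (Function.Injective z ∧ (∀ i, (z i : V) ∈ G.vertexSet) ∧
      ∀ j, P j z) ∧ Set.range (fun i => (z i : V)) ∈ G.edgeSet} ≤
      #{x : Fin k → S | (∀ j, P j x) ∧ univ.image x ∈ G.edgesOn S} := by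
    refine card_le_card fun z hz => ?_
    simp only [mem_filter, mem_univ, true_and] at hz ⊢
    refine ⟨hz.1.2.2, ?_⟩
    change Subtype.val '' ((univ.image z : Finset S) : Set S) ∈ G.edgeSet
    rw [coe_image, coe_univ, Set.image_univ, ← Set.range_comp]
    exact hz.2
  have h3 : (#{z : Fin k → S | ¬ Function.Injective z} : ℝ) * Fintype.card S ≤
      k ^ 2 * (Fintype.card S : ℝ) ^ k := by
    have := card_filter_not_injective_mul_le (ι := Fin k) (W := S)
    rw [Fintype.card_fin] at this
    exact_mod_cast this
  have h4 : (#{z : Fin k → S | ∃ i, z i ∈ B} : ℝ) * Fintype.card S ≤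
      k * (Fintype.card S : ℝ) ^ k := by
    have h5 := card_filter_exists_mem_mul_le (ι := Fin k) B
    rw [Fintype.card_fin] at h5
    have h6 : #{z : Fin k → S | ∃ i, z i ∈ B} * Fintype.card S ≤ k * Fintype.card S ^ k := by
      have := h5.trans (Nat.mul_le_mul_right _ ((Nat.mul_le_mul_left k hmiss).trans_eq (mul_one k)))
      refine (le_of_eq ?_).trans this
      congr!
    exact_mod_cast h6
  have h5 : (#{z : Fin k → S | ¬ Function.Injective z} : ℝ) + #{z : Fin k → S | ∃ i, z i ∈ B} ≤
      (k ^ 2 + k) / Fintype.card S * (Fintype.card S : ℝ) ^ k := by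
    rw [div_mul_eq_mul_div, le_div_iff₀ hn]
    linarith
  have h1' : (#{x : Fin k → S | ∀ j, P j x} : ℝ) ≤
      #{z : Fin k → S | Function.Injective z ∧ (∀ i, (z i : V) ∈ G.vertexSet) ∧ ∀ j, P j z} +
      #{z : Fin k → S | ¬ Function.Injective z} + #{z : Fin k → S | ∃ i, z i ∈ B} := by
    exact_mod_cast h1
  have h2' : (#{z : Fin k → S | (Function.Injective z ∧ (∀ i, (z i : V) ∈ G.vertexSet) ∧
      ∀ j, P j z) ∧ Set.range (fun i => (z i : V)) ∈ G.edgeSet} : ℝ) ≤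
      #{x : Fin k → S | (∀ j, P j x) ∧ univ.image x ∈ G.edgesOn S} := by exact_mod_cast h2
  have h6 := mul_le_mul_of_nonneg_left h1' hp0
  have h7 : p * ((#{z : Fin k → S | ¬ Function.Injective z} : ℝ) +
      #{z : Fin k → S | ∃ i, z i ∈ B}) ≤
      #{z : Fin k → S | ¬ Function.Injective z} + #{z : Fin k → S | ∃ i, z i ∈ B} :=
    mul_le_of_le_one_left (by positivity) hp1
  linarith

/-! ### Counting cliques and absorbers. -/

section Cliques

variable {W : Type*} [DecidableEq W] {k r : ℕ} {𝓔 : Set (Finset W)} {q ε : ℝ}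

/-- `S` has `r` elements and all its `k`-subsets belong to `𝓔`. -/
def IsCliqueSet (𝓔 : Set (Finset W)) (k r : ℕ) (S : Finset W) : Prop :=
  #S = r ∧ ∀ T ⊆ S, #T = k → T ∈ 𝓔

/-- The link of `w` in `𝓔`. -/
def linkSet (𝓔 : Set (Finset W)) (w : W) : Set (Finset W) :=
  {T | insert w T ∈ 𝓔}

/-- Every large set contains a clique. -/
theorem exists_isCliqueSet_subset [Fintype W] (hk : 2 ≤ k) (hq0 : 0 ≤ q) (hq1 : q ≤ 1) (hε : 0 ≤ ε)
    (h𝓔 : OrdDisc k 𝓔 q ε) {γ : ℝ} (hγ : 0 ≤ γ) (hn : 0 < Fintype.card W)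
    (hbig : 2 ^ r * ε * Fintype.card W + r ^ 2 < q ^ 2 ^ r * γ ^ r * Fintype.card W)
    {U : Finset W} (hU : γ * Fintype.card W ≤ #U) : ∃ S ⊆ U, IsCliqueSet 𝓔 k r S := by
  classical
  have hn' : (0 : ℝ) < Fintype.card W := by exact_mod_cast hn
  obtain ⟨A, hA, h⟩ :=
    exists_counting (ι := Fin r) (𝓔 := fun _ => 𝓔) hq0 hq1 hε U (powersetCard k univ)
      (Or.inr fun e he => by rw [(mem_powersetCard.1 he).2]; exact hk)
      (fun e he => by rw [(mem_powersetCard.1 he).2]; exact h𝓔)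
  have hcard : #(powersetCard k (univ : Finset (Fin r))) ≤ 2 ^ r := by
    refine (card_le_univ _).trans ?_
    simp
  have hcard' : (#(powersetCard k (univ : Finset (Fin r))) : ℝ) ≤ 2 ^ r := by exact_mod_cast hcard
  rw [Fintype.card_fin] at h
  have h1 : q ^ 2 ^ r * (γ ^ r * (Fintype.card W : ℝ) ^ r) ≤
      q ^ #(powersetCard k (univ : Finset (Fin r))) * (#U : ℝ) ^ r := by
    rw [← mul_pow]
    exact mul_le_mul (pow_le_pow_of_le_one hq0 hq1 hcard) (pow_le_pow_left₀ (by positivity) hU r)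
      (by positivity) (by positivity)
  have h2 : (#(powersetCard k (univ : Finset (Fin r))) : ℝ) * ε * (Fintype.card W : ℝ) ^ r ≤
      2 ^ r * ε * (Fintype.card W : ℝ) ^ r := by gcongr
  have h3 : (#{f : Fin r → W | ¬ Function.Injective f} : ℝ) * Fintype.card W ≤
      r ^ 2 * (Fintype.card W : ℝ) ^ r := by
    have := card_filter_not_injective_mul_le (ι := Fin r) (W := W)
    rw [Fintype.card_fin] at this
    exact_mod_cast this
  -- More tuples are counted than fail to be injective, so some counted tuple has `r` distinct
  -- entries.
  have h4 : (#{f : Fin r → W | ¬ Function.Injective f} : ℝ) < #A := by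
    refine lt_of_mul_lt_mul_right ?_ hn'.le
    refine h3.trans_lt (lt_of_lt_of_le ?_ (mul_le_mul_of_nonneg_right
      ((sub_le_sub h1 h2).trans h) hn'.le))
    have := mul_lt_mul_of_pos_right hbig (pow_pos hn' r)
    linarith
  obtain ⟨f, hf, hinj⟩ := exists_mem_notMem_of_card_lt_card (by exact_mod_cast h4)
  replace hf := hA f hf
  simp only [mem_filter, mem_univ, true_and, not_not] at hinj
  refine ⟨univ.image f, fun w hw => ?_, ?_, fun T hT hTk => ?_⟩
  · obtain ⟨i, -, rfl⟩ := mem_image.1 hw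
    exact hf.1 i
  · rw [card_image_of_injective _ hinj, card_univ, Fintype.card_fin]
  · obtain ⟨e, -, rfl⟩ := subset_image_iff.1 hT
    rw [card_image_of_injective _ hinj] at hTk
    exact hf.2 e (mem_powersetCard.2 ⟨subset_univ _, hTk⟩)

/-- `f` is an absorber for `x`: adding the tuple `x` as a column to the grid `f` makes all rows
cliques, and the columns of `f` itself are cliques. -/
structure IsAbsorber (𝓔 : Set (Finset W)) (k r : ℕ) (x : Fin r → W)
    (f : Fin r × Fin (r - 1) → W) : Prop where
  injective : Function.Injective f
  ne : ∀ i v, x i ≠ f v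
  row : ∀ i, IsCliqueSet 𝓔 k r (insert (x i) (({v | v.1 = i} : Finset (Fin r × Fin (r - 1))).image f))
  column : ∀ j, IsCliqueSet 𝓔 k r (({v | v.2 = j} : Finset (Fin r × Fin (r - 1))).image f)

/-- The constraints of an absorber: `k`-sets within a row or a column are to be edges, and
`(k - 1)`-sets within a row are to be link edges. -/
def gridConstraints (k r : ℕ) : Finset (Finset (Fin r × Fin (r - 1))) :=
  {e | (#e = k ∧ ((∃ i, ∀ v ∈ e, v.1 = i) ∨ ∃ j, ∀ v ∈ e, v.2 = j)) ∨
    (#e = k - 1 ∧ ∃ i, ∀ v ∈ e, v.1 = i)}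

open Classical in
/-- The family in which the image of the constraint `e` has to lie. -/
noncomputable def gridFamily (𝓔 : Set (Finset W)) (k r : ℕ) (x : Fin r → W)
    (e : Finset (Fin r × Fin (r - 1))) : Set (Finset W) :=
  if #e = k then 𝓔 else if h : e.Nonempty then linkSet 𝓔 (x h.choose.1) else ∅

/-- All points of `e` lie in one row, so the arbitrary choice made in `gridFamily` does not matter.
-/
theorem gridFamily_of_row (hk : 2 ≤ k) (x : Fin r → W) {e : Finset (Fin r × Fin (r - 1))}
    (he : #e = k - 1) {i : Fin r} (hi : ∀ v ∈ e, v.1 = i) :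
    gridFamily 𝓔 k r x e = linkSet 𝓔 (x i) := by
  have hne : e.Nonempty := card_pos.1 (by omega)
  rw [gridFamily, if_neg (by omega), dif_pos hne, hi _ hne.choose_spec]

/-- A `k`-subset of an extended row either avoids `x i`, and is a constrained `k`-set, or becomes a
constrained link edge after `x i` is removed. -/
theorem isAbsorber_of_constraints (hk : 2 ≤ k) (hr : 0 < r) {x : Fin r → W}
    {f : Fin r × Fin (r - 1) → W} (hinj : Function.Injective f) (hne : ∀ i v, x i ≠ f v)
    (hf : ∀ e ∈ gridConstraints k r, e.image f ∈ gridFamily 𝓔 k r x e) :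
    IsAbsorber 𝓔 k r x f := by
  have hk1 : ∀ e : Finset (Fin r × Fin (r - 1)), #e = k →
      ((∃ i, ∀ v ∈ e, v.1 = i) ∨ ∃ j, ∀ v ∈ e, v.2 = j) → e.image f ∈ 𝓔 := by
    intro e he h
    have := hf e (by simp only [gridConstraints, mem_filter, mem_univ, true_and]; exact Or.inl ⟨he, h⟩)
    rwa [gridFamily, if_pos he] at this
  have hrow : ∀ i : Fin r, #({v | v.1 = i} : Finset (Fin r × Fin (r - 1))) = r - 1 := by
    intro i
    have : ({v | v.1 = i} : Finset (Fin r × Fin (r - 1))) = {i} ×ˢ univ := by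
      ext v; simp only [mem_filter, mem_univ, true_and, mem_product, mem_singleton, and_true]
    rw [this, card_product]; simp
  have hcol : ∀ j : Fin (r - 1), #({v | v.2 = j} : Finset (Fin r × Fin (r - 1))) = r := by
    intro j
    have : ({v | v.2 = j} : Finset (Fin r × Fin (r - 1))) = univ ×ˢ {j} := by
      ext v; simp only [mem_filter, mem_univ, true_and, mem_product, mem_singleton]
    rw [this, card_product]; simp
  refine ⟨hinj, hne, fun i => ⟨?_, fun T hT hTk => ?_⟩, fun j => ⟨?_, fun T hT hTk => ?_⟩⟩
  · rw [card_insert_of_notMem, card_image_of_injective _ hinj, hrow, Nat.sub_add_cancel hr]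
    rintro h
    obtain ⟨v, -, h⟩ := mem_image.1 h
    exact hne i v h.symm
  · by_cases hx : x i ∈ T
    · have hT' : T.erase (x i) ⊆ ({v | v.1 = i} : Finset (Fin r × Fin (r - 1))).image f := by
        rwa [← subset_insert_iff]
      obtain ⟨e, he, heT⟩ := subset_image_iff.1 hT'
      have hcard : #e = k - 1 := by
        rw [← card_image_of_injective e hinj, heT, card_erase_of_mem hx, hTk]
      have hei : ∀ v ∈ e, v.1 = i := fun v hv => by simpa using he hv
      have := hf e (by
        simp only [gridConstraints, mem_filter, mem_univ, true_and]; exact Or.inr ⟨hcard, i, hei⟩)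
      rw [gridFamily_of_row hk x hcard hei, heT] at this
      change insert (x i) (T.erase (x i)) ∈ 𝓔 at this
      rwa [insert_erase hx] at this
    · obtain ⟨e, he, rfl⟩ := subset_image_iff.1 ((subset_insert_iff_of_notMem hx).1 hT)
      rw [card_image_of_injective _ hinj] at hTk
      exact hk1 e hTk (Or.inl ⟨i, fun v hv => by simpa using he hv⟩)
  · rw [card_image_of_injective _ hinj, hcol]
  · obtain ⟨e, he, rfl⟩ := subset_image_iff.1 hT
    rw [card_image_of_injective _ hinj] at hTk
    exact hk1 e hTk (Or.inr ⟨j, fun v hv => by simpa using he hv⟩)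

open Classical in
/-- Every tuple has a positive proportion of absorbers, even when a small set is to be avoided. -/
theorem card_isAbsorber [Fintype W] (hk : 2 ≤ k) (hr : 0 < r) (hq0 : 0 ≤ q) (hq1 : q ≤ 1) (hε : 0 ≤ ε)
    (h𝓔 : OrdDisc k 𝓔 q ε) (hlink : ∀ w, OrdDisc (k - 1) (linkSet 𝓔 w) q ε)
    (hn : 0 < Fintype.card W) {M b : ℕ} {c : ℝ} (hM : M = r * (r - 1))
    (hbig : c * Fintype.card W + 2 ^ M * ε * Fintype.card W + M ^ 2 + M * (b + r) ≤
      q ^ 2 ^ M * Fintype.card W) (x : Fin r → W) (B : Finset W) (hB : #B ≤ b) :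
    c * Fintype.card (Fin r × Fin (r - 1) → W) ≤
      #{f : Fin r × Fin (r - 1) → W | IsAbsorber 𝓔 k r x f ∧ Disjoint (univ.image f) B} := by
  have hn' : (0 : ℝ) < Fintype.card W := by exact_mod_cast hn
  have hιM : Fintype.card (Fin r × Fin (r - 1)) = M := by simp [hM]
  -- Link constraints have size `1` when `k = 2`, so the count is over all of `W`; tuples meeting
  -- `B` or `x` are discarded afterwards.
  obtain ⟨A, hA, h⟩ :=
    exists_counting (𝓔 := gridFamily 𝓔 k r x) hq0 hq1 hε univ (gridConstraints k r)
      (Or.inl rfl) (fun e he => by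
        simp only [gridConstraints, mem_filter, mem_univ, true_and] at he
        rcases he with ⟨he, -⟩ | ⟨he, i, hi⟩
        · rw [gridFamily, if_pos he, he]; exact h𝓔
        · rw [gridFamily_of_row hk x he hi, he]; exact hlink _)
  rw [card_univ, ← sub_mul, hιM] at h
  have hcard : #(gridConstraints k r) ≤ 2 ^ M := by
    refine (card_le_univ _).trans ?_
    rw [Fintype.card_finset, hιM]
  have hcard' : (#(gridConstraints k r) : ℝ) ≤ 2 ^ M := by exact_mod_cast hcard
  have h1 : q ^ 2 ^ M - 2 ^ M * ε ≤ q ^ #(gridConstraints k r) - #(gridConstraints k r) * ε := by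
    have := pow_le_pow_of_le_one hq0 hq1 hcard
    gcongr
  have h2 : A ⊆ (univ.filter (fun f => IsAbsorber 𝓔 k r x f ∧ Disjoint (univ.image f) B) ∪
      univ.filter fun f => ¬ Function.Injective f) ∪
        univ.filter fun f => ∃ v, f v ∈ B ∪ univ.image x := by
    intro f hf
    replace hf := (hA f hf).2
    simp only [mem_union, mem_filter, mem_univ, true_and]
    by_cases hinj : Function.Injective f
    · by_cases hB : ∃ v, f v ∈ B ∨ f v ∈ univ.image x
      · exact Or.inr hB
      · push Not at hB
        refine Or.inl (Or.inl ⟨isAbsorber_of_constraints hk hr hinj (fun i v h => ?_) hf, ?_⟩)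
        · exact (hB v).2 (mem_image.2 ⟨i, mem_univ _, h⟩)
        · rw [disjoint_left]
          intro w hw
          obtain ⟨v, -, rfl⟩ := mem_image.1 hw
          exact (hB v).1
    · exact Or.inl (Or.inr hinj)
  have h3 : (#A : ℝ) ≤ #{f | IsAbsorber 𝓔 k r x f ∧ Disjoint (univ.image f) B} +
      #{f : Fin r × Fin (r - 1) → W | ¬ Function.Injective f} +
      #{f : Fin r × Fin (r - 1) → W | ∃ v, f v ∈ B ∪ univ.image x} := by
    exact_mod_cast (card_le_card h2).trans
      ((card_union_le _ _).trans (Nat.add_le_add_right (card_union_le _ _) _))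
  have h4 : (#{f : Fin r × Fin (r - 1) → W | ¬ Function.Injective f} : ℝ) * Fintype.card W ≤
      M ^ 2 * (Fintype.card W : ℝ) ^ M := by
    have := card_filter_not_injective_mul_le (ι := Fin r × Fin (r - 1)) (W := W)
    rw [hιM] at this
    exact_mod_cast this
  have h5 : (#{f : Fin r × Fin (r - 1) → W | ∃ v, f v ∈ B ∪ univ.image x} : ℝ) *
      Fintype.card W ≤ M * (b + r) * (Fintype.card W : ℝ) ^ M := by
    have h6 := card_filter_exists_mem_mul_le (ι := Fin r × Fin (r - 1)) (B ∪ univ.image x)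
    have h7 : #(B ∪ univ.image x) ≤ b + r :=
      (card_union_le _ _).trans (add_le_add hB (card_image_le.trans (by simp)))
    rw [hιM] at h6
    exact_mod_cast h6.trans (Nat.mul_le_mul_right _ (Nat.mul_le_mul_left _ h7))
  have h6 : (Fintype.card (Fin r × Fin (r - 1) → W) : ℝ) = (Fintype.card W : ℝ) ^ M := by
    rw [Fintype.card_fun, hιM, Nat.cast_pow]
  rw [h6]
  refine le_of_mul_le_mul_right ?_ hn'
  have hpow : (0 : ℝ) < (Fintype.card W : ℝ) ^ M := pow_pos hn' M
  have h7 := mul_le_mul_of_nonneg_right hbig hpow.le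
  have h8 := mul_le_mul_of_nonneg_right ((mul_le_mul_of_nonneg_right h1 hpow.le).trans
    (h.trans h3)) hn'.le
  linarith

theorem tiled_image_of_columns {f : Fin r × Fin (r - 1) → W}
    (h : Function.Injective f)
    (hcol : ∀ j, IsCliqueSet 𝓔 k r (({v | v.2 = j} : Finset (Fin r × Fin (r - 1))).image f)) :
    Tiled (IsCliqueSet 𝓔 k r) (univ.image f) := by
  have : univ.image f = (univ : Finset (Fin (r - 1))).biUnion fun j =>
      ({v | v.2 = j} : Finset (Fin r × Fin (r - 1))).image f := by
    ext w
    simp only [mem_image, mem_univ, true_and, mem_biUnion, mem_filter]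
    exact ⟨fun ⟨v, hv⟩ => ⟨v.2, v, rfl, hv⟩, fun ⟨_, v, _, hv⟩ => ⟨v, hv⟩⟩
  rw [this]
  refine .biUnion (fun j _ => .of_tile (hcol j)) fun j _ j' _ hj => ?_
  rw [Function.onFun, disjoint_left]
  simp only [mem_image, mem_filter, mem_univ, true_and]
  rintro w ⟨v, hv, rfl⟩ ⟨v', hv', hvv⟩
  exact hj (by rw [← hv, ← hv', h hvv])

/-- With `x` adjoined the grid is cut into rows instead of columns; this switch is the absorption.
-/
theorem IsAbsorber.tiled_union {x : Fin r → W} {f : Fin r × Fin (r - 1) → W}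
    (h : IsAbsorber 𝓔 k r x f) (hx : Function.Injective x) :
    Tiled (IsCliqueSet 𝓔 k r) (univ.image x ∪ univ.image f) := by
  have : univ.image x ∪ univ.image f = (univ : Finset (Fin r)).biUnion fun i =>
      insert (x i) (({v | v.1 = i} : Finset (Fin r × Fin (r - 1))).image f) := by
    ext w
    simp only [mem_union, mem_image, mem_univ, true_and, mem_biUnion, mem_insert, mem_filter]
    constructor
    · rintro (⟨i, rfl⟩ | ⟨v, rfl⟩)
      · exact ⟨i, Or.inl rfl⟩
      · exact ⟨v.1, Or.inr ⟨v, rfl, rfl⟩⟩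
    · rintro ⟨i, rfl | ⟨v, -, rfl⟩⟩
      · exact Or.inl ⟨i, rfl⟩
      · exact Or.inr ⟨v, rfl⟩
  rw [this]
  refine .biUnion (fun i _ => .of_tile (h.row i)) fun i _ i' _ hi => ?_
  rw [Function.onFun, disjoint_left]
  simp only [mem_insert, mem_image, mem_filter, mem_univ, true_and]
  rintro w (rfl | ⟨v, hv, rfl⟩) (hw | ⟨v', hv', hvv⟩)
  · exact hi (hx hw)
  · exact h.ne _ _ hvv.symm
  · exact h.ne _ _ hw.symm
  · exact hi (by rw [← hv, ← hv', h.injective hvv])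

end Cliques

/-! ### The absorbing argument. -/

section Packing

variable {W : Type*} [DecidableEq W] [Fintype W] {k r : ℕ} {𝓔 : Set (Finset W)} {q ε : ℝ}

/-- The absorbing argument, with explicit bounds on the parameters. -/
theorem tiled_univ_of_bounds (hk : 2 ≤ k) (hkr : k ≤ r) (hq0 : 0 ≤ q) (hq1 : q ≤ 1) (hε : 0 ≤ ε)
    (h𝓔 : OrdDisc k 𝓔 q ε) (hlink : ∀ w, OrdDisc (k - 1) (linkSet 𝓔 w) q ε)
    (hn : 0 < Fintype.card W) (hdvd : r ∣ Fintype.card W) {M l t : ℕ} {c γ : ℝ} (hc : 0 < c)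
    (hM : M = r * (r - 1)) (hγ : 0 ≤ γ) (hl : (1 - c / 2) ^ l ≤ 1 / 4)
    (habs : c * Fintype.card W + 2 ^ M * ε * Fintype.card W + M ^ 2 +
      M * ((l * t * M : ℕ) + r) ≤ q ^ 2 ^ M * Fintype.card W)
    (hclique : 2 ^ r * ε * Fintype.card W + r ^ 2 < q ^ 2 ^ r * γ ^ r * Fintype.card W)
    (hγt : γ * Fintype.card W ≤ (r * t : ℕ)) (hpow : Fintype.card W ^ r ≤ 2 ^ t)
    (hc1 : c ≤ 1) :
    Tiled (IsCliqueSet 𝓔 k r) univ := by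
  classical
  have hr : 0 < r := by omega
  have hW : Nonempty W := Fintype.card_pos_iff.1 hn
  have hι : Nonempty (Fin r × Fin (r - 1)) := ⟨⟨0, hr⟩, ⟨0, by omega⟩⟩
  have hιM : Fintype.card (Fin r × Fin (r - 1)) = M := by simp [hM]
  have hempty : ¬ IsCliqueSet 𝓔 k r ∅ := fun h => by
    have := h.1
    simp at this
    omega
  obtain ⟨𝓕, -, hgood, hdisj, hpot⟩ := exists_disjoint_family
    (R := IsAbsorber 𝓔 k r) (good := fun f => Function.Injective f ∧
      ∀ j, IsCliqueSet 𝓔 k r (({v | v.2 = j} : Finset (Fin r × Fin (r - 1))).image f))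
    (g := fun f => univ.image f) (s := M) (b := l * t * M) hc
    (fun x f h => ⟨h.injective, h.column⟩)
    (fun f => card_image_le.trans (by rw [card_univ, hιM])) (fun f => univ_nonempty.image f)
    (fun x B hB => (card_isAbsorber hk hr hq0 hq1 hε h𝓔 hlink hn hM habs x B hB).trans
      (le_of_eq (by congr!))) (l * t) le_rfl
  -- A single term of the potential is at most `n ^ r * 4 ^ (-t) ≤ 2 ^ (-t)`, where `n = |W|`.
  have hmany : ∀ x : Fin r → W, t ≤ #{f ∈ 𝓕 | IsAbsorber 𝓔 k r x f} := by
    intro x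
    have h1 : (1 / 2 : ℝ) ^ #{f ∈ 𝓕 | IsAbsorber 𝓔 k r x f} ≤
        Fintype.card (Fin r → W) * (1 - c / 2) ^ (l * t) :=
      (single_le_sum (f := fun x => (1 / 2 : ℝ) ^ #{f ∈ 𝓕 | IsAbsorber 𝓔 k r x f})
        (fun _ _ => by positivity) (mem_univ x)).trans hpot
    have h2 : (1 - c / 2) ^ (l * t) ≤ (1 / 4 : ℝ) ^ t := by
      rw [pow_mul]
      exact pow_le_pow_left₀ (pow_nonneg (by linarith) l) hl t
    have h3 : (Fintype.card (Fin r → W) : ℝ) ≤ 2 ^ t := by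
      rw [Fintype.card_fun, Fintype.card_fin]
      exact_mod_cast hpow
    have h4 : (1 / 2 : ℝ) ^ #{f ∈ 𝓕 | IsAbsorber 𝓔 k r x f} ≤ (1 / 2) ^ t := by
      refine h1.trans ((mul_le_mul h3 h2 (pow_nonneg (by linarith) _) (by positivity)).trans ?_)
      rw [← mul_pow]
      norm_num
    exact (pow_le_pow_iff_right_of_lt_one₀ (by norm_num) (by norm_num)).1 h4
  set A : Finset W := 𝓕.biUnion fun f => univ.image f with hA
  have htile : ∀ f ∈ 𝓕, Tiled (IsCliqueSet 𝓔 k r) (univ.image f) := fun f hf =>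
    tiled_image_of_columns (hgood f hf).1 (hgood f hf).2
  have hAt : Tiled (IsCliqueSet 𝓔 k r) A := .biUnion htile hdisj
  obtain ⟨T, hTA, hT, hsmall⟩ := exists_tiled_subset (t := r * t) hempty
    (fun U hU => exists_isCliqueSet_subset hk hq0 hq1 hε h𝓔 hγ hn hclique
      (hγt.trans (by exact_mod_cast hU))) (univ \ A)
  set L := (univ \ A) \ T with hL
  have hLA : Disjoint L A := disjoint_of_subset_left sdiff_subset sdiff_disjoint
  have hTLA : Disjoint T (L ∪ A) := disjoint_union_right.2
    ⟨disjoint_sdiff, disjoint_of_subset_left hTA sdiff_disjoint⟩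
  have huniv : (univ : Finset W) = T ∪ (L ∪ A) := by
    rw [← union_assoc, hL, union_sdiff_of_subset hTA, sdiff_union_of_subset (subset_univ A)]
  have hLr : r ∣ #L := by
    rw [← card_univ, huniv, card_union_of_disjoint hTLA, card_union_of_disjoint hLA] at hdvd
    have h1 := hT.dvd_card fun S h => h.1
    have h2 := hAt.dvd_card fun S h => h.1
    exact (Nat.dvd_add_left h2).1 ((Nat.dvd_add_right h1).1 hdvd)
  obtain ⟨s, hs⟩ := hLr
  have hst : s ≤ t := by
    rw [hs] at hsmall
    exact (lt_of_mul_lt_mul_left hsmall (Nat.zero_le r)).le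
  rw [huniv]
  refine hT.union ?_ hTLA
  refine tiled_union_biUnion_of_absorbing (r := r)
    (fun X f => Tiled (IsCliqueSet 𝓔 k r) (X ∪ univ.image f)) s 𝓕 L htile hdisj hs hLA
    (fun _ _ h => h) fun X _ hX => ?_
  let x : Fin r → W := fun i => (X.equivFinOfCardEq hX).symm i
  have hx : Function.Injective x :=
    Subtype.val_injective.comp (X.equivFinOfCardEq hX).symm.injective
  have hxX : univ.image x = X := by
    refine eq_of_subset_of_card_le (fun w hw => ?_) ?_
    · obtain ⟨i, -, rfl⟩ := mem_image.1 hw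
      exact ((X.equivFinOfCardEq hX).symm i).2
    · rw [card_image_of_injective _ hx, card_univ, Fintype.card_fin, hX]
  refine hst.trans ((hmany x).trans (card_le_card fun f hf => ?_))
  rw [mem_filter] at hf ⊢
  exact ⟨hf.1, hxX ▸ hf.2.tiled_union hx⟩

end Packing

/-! ### Choice of constants. -/

theorem exists_pow_le_two_pow_div (r D : ℕ) (hD : 0 < D) :
    ∃ n₀ : ℕ, ∀ n ≥ n₀, n ^ r ≤ 2 ^ (n / D) := by
  have h := tendsto_pow_const_div_const_pow_of_one_lt r (one_lt_two (α := ℝ))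
  -- With `t = n / D` one has `n ≤ D * (t + 1)`; the factor `2` turns `2 ^ (t + 1)` into `2 ^ t`.
  have hpos : (0 : ℝ) < 1 / (2 * D ^ r) := by positivity
  obtain ⟨t₀, ht₀⟩ := Filter.eventually_atTop.1 (h.eventually (gt_mem_nhds hpos))
  refine ⟨D * t₀, fun n hn => ?_⟩
  have ht : t₀ ≤ n / D := by rwa [Nat.le_div_iff_mul_le hD, mul_comm]
  have h1 := ht₀ (n / D + 1) (by omega)
  rw [div_lt_div_iff₀ (by positivity) (by positivity), one_mul] at h1
  have h2 : n ≤ D * (n / D + 1) := (Nat.lt_mul_div_succ n hD).le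
  have h3 : (D : ℝ) ^ r * ((n / D + 1 : ℕ) : ℝ) ^ r ≤ 2 ^ (n / D) := by
    rw [pow_succ] at h1
    linarith
  rw [← mul_pow] at h3
  exact (Nat.pow_le_pow_left h2 r).trans (by exact_mod_cast h3)

universe u in
/-- Sets of size divisible by `r` can be tiled with cliques if `𝓔` and its links have small
discrepancy. -/
theorem exists_tiled_univ {k r : ℕ} (hk : 2 ≤ k) (hkr : k ≤ r) {q : ℝ} (hq0 : 0 < q) (hq1 : q ≤ 1) :
    ∃ (ε : ℝ) (n₀ : ℕ), 0 < ε ∧ ε ≤ 1 ∧ ∀ (W : Type u) [DecidableEq W] [Fintype W]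
      (𝓔 : Set (Finset W)), n₀ ≤ Fintype.card W → r ∣ Fintype.card W → OrdDisc k 𝓔 q ε →
      (∀ w, OrdDisc (k - 1) (linkSet 𝓔 w) q ε) → Tiled (IsCliqueSet 𝓔 k r) univ := by
  obtain ⟨M, hM⟩ : ∃ M, M = r * (r - 1) := ⟨_, rfl⟩
  -- The four quarters pay for the absorbers wanted, the discrepancy error, the constant terms, and
  -- the vertices already used.
  obtain ⟨c, hc⟩ : ∃ c, c = q ^ 2 ^ M / 4 := ⟨_, rfl⟩
  have hc0 : 0 < c := by rw [hc]; positivity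
  have hc1 : c ≤ 1 := by
    have : q ^ 2 ^ M ≤ 1 := pow_le_one₀ hq0.le hq1
    linarith
  obtain ⟨l, hl⟩ := exists_pow_lt_of_lt_one (by norm_num : (0 : ℝ) < 1 / 4)
    (by linarith : 1 - c / 2 < 1)
  -- The parameter `t` will be `n / D`; this `D` keeps the loss `M ^ 2 * l * t` from used vertices
  -- below `c * n`.
  obtain ⟨D, hD⟩ := exists_nat_gt ((M : ℝ) ^ 2 * l / c)
  have hD0 : (0 : ℝ) < D := lt_of_le_of_lt (by positivity) hD
  have hr : (1 : ℝ) ≤ r := by exact_mod_cast (by omega : 1 ≤ r)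
  -- Rounding down loses at most half once `n ≥ 2 * D`, so `γ * n ≤ t`.
  obtain ⟨γ, hγ⟩ : ∃ γ : ℝ, γ = 1 / (2 * D) := ⟨_, rfl⟩
  have hγ0 : 0 < γ := by rw [hγ]; positivity
  obtain ⟨δ, hδ⟩ : ∃ δ, δ = q ^ 2 ^ r * γ ^ r := ⟨_, rfl⟩
  have hδ0 : 0 < δ := by rw [hδ]; positivity
  obtain ⟨n₁, hn₁⟩ := exists_pow_le_two_pow_div r D (by exact_mod_cast hD0)
  obtain ⟨n₂, hn₂⟩ := exists_nat_gt (((M : ℝ) ^ 2 + M * r) / c)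
  obtain ⟨n₃, hn₃⟩ := exists_nat_gt ((r : ℝ) ^ 2 * 2 / δ)
  obtain ⟨ε, hε0, hε1, hεM, hεr⟩ :
      ∃ ε : ℝ, 0 < ε ∧ ε ≤ 1 ∧ 2 ^ M * ε ≤ c ∧ 2 ^ r * ε ≤ δ / 2 := by
    refine ⟨min 1 (min (c / 2 ^ M) (δ / 2 / 2 ^ r)), by positivity, min_le_left _ _, ?_, ?_⟩
    · rw [← le_div_iff₀' (by positivity)]
      exact (min_le_right _ _).trans (min_le_left _ _)
    · rw [← le_div_iff₀' (by positivity)]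
      exact (min_le_right _ _).trans (min_le_right _ _)
  refine ⟨ε, n₁ + n₂ + n₃ + 2 * D + 1, hε0, hε1, fun W _ _ 𝓔 hn hdvd h𝓔 hlink => ?_⟩
  have hn0 : (0 : ℝ) < Fintype.card W := by exact_mod_cast (by omega : 0 < Fintype.card W)
  have hn2 : (n₂ : ℝ) ≤ Fintype.card W := by exact_mod_cast (by omega : n₂ ≤ Fintype.card W)
  have hn3 : (n₃ : ℝ) ≤ Fintype.card W := by exact_mod_cast (by omega : n₃ ≤ Fintype.card W)
  have hnD : (2 * D : ℝ) ≤ Fintype.card W := by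
    exact_mod_cast (by omega : 2 * D ≤ Fintype.card W)
  have ht1 : ((Fintype.card W / D : ℕ) : ℝ) * D ≤ Fintype.card W := by
    exact_mod_cast Nat.div_mul_le_self _ _
  have ht2 : (Fintype.card W : ℝ) ≤ D * ((Fintype.card W / D : ℕ) + 1) := by
    exact_mod_cast (Nat.lt_mul_div_succ _ (by exact_mod_cast hD0)).le
  refine tiled_univ_of_bounds hk hkr hq0.le hq1 hε0.le h𝓔 hlink (by exact_mod_cast hn0) hdvd
    (l := l) (t := Fintype.card W / D) hc0 hM hγ0.le hl.le ?_ ?_ ?_ (hn₁ _ (by omega)) hc1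
  · have h1 : (M : ℝ) ^ 2 * l * (Fintype.card W / D : ℕ) ≤ c * Fintype.card W := by
      rw [div_lt_iff₀ hc0] at hD
      calc _ ≤ D * c * ((Fintype.card W / D : ℕ) : ℝ) := by gcongr
        _ = c * (((Fintype.card W / D : ℕ) : ℝ) * D) := by ring
        _ ≤ _ := by gcongr
    have h2 : (M : ℝ) ^ 2 + M * r ≤ c * Fintype.card W := by
      rw [div_lt_iff₀ hc0] at hn₂
      nlinarith
    have h3 : 2 ^ M * ε * Fintype.card W ≤ c * Fintype.card W := by gcongr
    have h4 : q ^ 2 ^ M = 4 * c := by rw [hc]; ring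
    rw [h4]
    push_cast at h1 ⊢
    linarith
  · rw [← hδ]
    have h1 : 2 ^ r * ε * Fintype.card W ≤ δ / 2 * Fintype.card W := by gcongr
    rw [div_lt_iff₀ hδ0] at hn₃
    have h2 : (n₃ : ℝ) * δ ≤ Fintype.card W * δ := by gcongr
    linarith
  · have h1 : γ * Fintype.card W ≤ (Fintype.card W / D : ℕ) := by
      rw [hγ, div_mul_eq_mul_div, one_mul, div_le_iff₀ (by positivity)]
      linarith
    push_cast at h1 ⊢
    have h2 : (0 : ℝ) ≤ (Fintype.card W / D : ℕ) := by positivity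
    nlinarith

/-! ### Return to hypergraphs. -/

/-- A tiling of the vertex set by cliques is a perfect packing. -/
theorem hasPerfectPacking_of_tiled {V : Type*} {H : Hypergraph V} [Fintype H.vertexSet]
    [DecidableEq H.vertexSet] {k r : ℕ}
    (h : Tiled (IsCliqueSet (H.edgesOn H.vertexSet) k r) univ) :
    HasPerfectPacking (completeUniform k r) H := by
  obtain ⟨P, hd, hcover, hP⟩ := h.exists_partition
  refine ⟨(fun T : Finset H.vertexSet => Subtype.val '' (T : Set H.vertexSet)) '' P, ?_, ?_, ?_⟩
  · rintro _ ⟨T, hT, rfl⟩ _ ⟨T', hT', rfl⟩ hne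
    have : Disjoint T T' := hd hT hT' fun h => hne (by rw [h])
    exact (Set.disjoint_image_iff Subtype.val_injective).2 (disjoint_coe.2 this)
  · ext v
    constructor
    · rintro ⟨_, ⟨T, -, rfl⟩, w, -, rfl⟩
      exact w.2
    · intro hv
      obtain ⟨T, hT, hvT⟩ := (hcover ⟨v, hv⟩).1 (mem_univ _)
      exact ⟨_, ⟨T, hT, rfl⟩, ⟨v, hv⟩, hvT, rfl⟩
  · rintro _ ⟨T, hT, rfl⟩
    obtain ⟨hcard, hTk⟩ := hP T hT
    let φ : Fin r → H.vertexSet := fun i => (T.equivFinOfCardEq hcard).symm i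
    have hφ : Function.Injective φ :=
      Subtype.val_injective.comp (T.equivFinOfCardEq hcard).symm.injective
    refine ⟨fun i => φ i, (Subtype.val_injective.comp hφ).injOn, ?_, fun e he => ?_⟩
    · ext v
      constructor
      · rintro ⟨i, -, rfl⟩
        exact ⟨φ i, ((T.equivFinOfCardEq hcard).symm i).2, rfl⟩
      · rintro ⟨w, hw, rfl⟩
        exact ⟨T.equivFinOfCardEq hcard ⟨w, hw⟩, Set.mem_univ _, by simp [φ]⟩
    · classical
      have he : e.encard = k := he
      have hsub : e.toFinset.image φ ⊆ T := by
        intro w hw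
        obtain ⟨i, -, rfl⟩ := mem_image.1 hw
        exact ((T.equivFinOfCardEq hcard).symm i).2
      have hk : #(e.toFinset.image φ) = k := by
        rw [card_image_of_injective _ hφ]
        rw [← Set.coe_toFinset e, Set.encard_coe_eq_coe_finsetCard] at he
        exact_mod_cast he
      have := hTk _ hsub hk
      change Subtype.val '' ((e.toFinset.image φ : Finset H.vertexSet) : Set H.vertexSet) ∈
        H.edgeSet at this
      rwa [coe_image, Set.coe_toFinset, Set.image_image] at this

theorem edgesOn_link_subset {V : Type*} {H : Hypergraph V} [DecidableEq H.vertexSet]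
    (w : H.vertexSet) :
    (H.link w).edgesOn H.vertexSet ⊆ linkSet (H.edgesOn H.vertexSet) w := by
  intro T hT
  change Subtype.val '' ((insert w T : Finset H.vertexSet) : Set H.vertexSet) ∈ H.edgeSet
  rw [coe_insert, Set.image_insert_eq]
  exact hT.2

end Hypergraph

theorem corollary2 (k r : ℕ) (hk : 2 ≤ k) (hkr : k ≤ r)
    (α p : ℝ) (hα0 : 0 < α) (hα1 : α < 1) (hp0 : 0 < p) (hp1 : p < 1) :
    ∃ (μ : ℝ) (n₀ : ℕ), 0 < μ ∧ μ < 1 ∧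
      ∀ (V : Type*) (H : Hypergraph V), H.vertexSet.Finite → H.IsUniform k →
        n₀ ≤ H.vertexSet.ncard → r ∣ H.vertexSet.ncard →
        H.DiscGE ((Finset.univ : Finset (Fin k)).powersetCard (k - 1)) p μ →
        (∀ x ∈ H.vertexSet,
          (H.link x).DiscGE ((Finset.univ : Finset (Fin (k - 1))).powersetCard (k - 2)) α μ) →
        Hypergraph.HasPerfectPacking (Hypergraph.completeUniform k r) H := by
  obtain ⟨ε, n₁, hε0, hε1, htile⟩ := Hypergraph.exists_tiled_univ hk hkr (lt_min hα0 hp0)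
    ((min_le_left α p).trans hα1.le)
  obtain ⟨n₂, hn₂⟩ := exists_nat_gt (((k : ℝ) ^ 2 + k) * 2 / ε)
  have hk1 : (1 : ℝ) ≤ k := by exact_mod_cast (by omega : 1 ≤ k)
  have hkk : (1 : ℝ) ≤ (k : ℝ) ^ k := one_le_pow₀ hk1
  -- Half of `ε` covers the colouring loss `k ^ k`; the other half, through `n₂`, covers degenerate
  -- tuples.
  refine ⟨ε / 2 / (k : ℝ) ^ k, n₁ + n₂ + 1, by positivity, ?_, ?_⟩
  · rw [div_lt_one (by positivity)]
    linarith
  intro V H hfin _ hn hdvd hH hlink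
  classical
  have := hfin.fintype
  have hcard : H.vertexSet.ncard = Fintype.card H.vertexSet := by
    rw [← Nat.card_coe_set_eq, Nat.card_eq_fintype_card]
  rw [hcard] at hn hdvd
  have hn0 : 0 < Fintype.card H.vertexSet := by omega
  have hn0' : (0 : ℝ) < Fintype.card H.vertexSet := by exact_mod_cast hn0
  have hbound : ∀ j : ℕ, j ≤ k → ε / 2 / (k : ℝ) ^ k * (j : ℝ) ^ j +
      ((j : ℝ) ^ 2 + j) / Fintype.card H.vertexSet ≤ ε := by
    intro j hj
    have hj' : (j : ℝ) ≤ k := by exact_mod_cast hj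
    have h1 : (j : ℝ) ^ j ≤ (k : ℝ) ^ k :=
      (pow_le_pow_left₀ (by positivity) hj' j).trans (pow_le_pow_right₀ hk1 hj)
    have h2 : ε / 2 / (k : ℝ) ^ k * (j : ℝ) ^ j ≤ ε / 2 := by
      rw [div_mul_eq_mul_div, div_le_iff₀ (by positivity)]
      gcongr
    have h3 : ((j : ℝ) ^ 2 + j) / Fintype.card H.vertexSet ≤ ε / 2 := by
      rw [div_le_iff₀ hn0']
      rw [div_lt_iff₀ hε0] at hn₂
      have h4 : (n₂ : ℝ) ≤ Fintype.card H.vertexSet := by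
        exact_mod_cast (by omega : n₂ ≤ Fintype.card H.vertexSet)
      have h5 : (j : ℝ) ^ 2 + j ≤ (k : ℝ) ^ 2 + k := by gcongr
      have h6 : (n₂ : ℝ) * ε ≤ Fintype.card H.vertexSet * ε := by gcongr
      linarith
    linarith
  refine Hypergraph.hasPerfectPacking_of_tiled (htile H.vertexSet _ (by omega) hdvd ?_ fun w => ?_)
  · refine (hH.ordDisc subset_rfl (by simp) (by omega) (by positivity) hp0.le hp1.le hn0).mono
      subset_rfl (min_le_right _ _) (hbound k le_rfl)
  · have hw := Hypergraph.DiscGE.ordDisc (G := H.link w) (S := H.vertexSet) (k := k - 1)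
      (hlink w w.2) Set.sdiff_subset ?_ (by omega) (by positivity) hα0.le hα1.le hn0
    · exact hw.mono (Hypergraph.edgesOn_link_subset w) (min_le_left _ _)
        (hbound (k - 1) (Nat.sub_le k 1))
    · refine (Finset.card_le_card fun v hv => ?_).trans (Finset.card_singleton w).le
      simp only [Finset.mem_filter, Finset.mem_univ, true_and] at hv
      rw [Finset.mem_singleton]
      by_contra hne
      exact hv ⟨v.2, fun h => hne (Subtype.ext h)⟩
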